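/- Let $m,n\ge 1$ be integers, not both equal to $1$. Let $K_{m,n}$ denote the metric space $X=\{u_1,\dots,u_m,v_1,\dots,v_n\}$ of $m+n$ points with the graph metric $d$ of the complete bipartite graph: $d(x,x)=0$ for every $x\in X$, $d(u_i,u_j)=2$ for $i\ne j$, $d(v_k,v_l)=2$ for $k\neq l$, and $d(u_i,v_k)=d(v_k,u_i)=1$ for all $i,k$. Put $$\wp_{m,n}=\log_2\left(\frac{2mn}{2mn-m-n}\right).$$ For $k\ge 2$ let $\mathcal O_k(\mathbb R)$ be the set of real symmetric positive semidefinite $k\times k$ matrices $Q$ with $Q\mathbf 1=0$, where $\mathbf 1$ is the vector with all entries $1$. For $0\le p<\infty$ and $1\le C<\infty$, a (semi-)metric space $(X,d)$ is said to have $p$-negative type with distortion $C$ if $$\sum_{q_{ij}>0}d(x_i,x_j)^p\,q_{ij}+C^2\sum_{q_{ij}<0}d(x_i,x_j)^p\,q_{ij}\le 0$$ for all $k\ge2$, all distinct $x_1,\dots,x_k\in X$ and all $Q=(q_{ij})_{i,j=1}^k\in\mathcal O_k(\mathbb R)$; it has strict $p$-negative type with distortion $C$ if, in addition, equality holds only for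 $Q=0$. (For $p=0$ the convention $d(x,x)^0=0$ is used.) Let $0\le p<\infty$ and $1\le C<\infty$. Then $K_{m,n}$ has strict $p$-negative type with distortion $C$ if and only if either $p<\wp_{m,n}$, or $p\ge\wp_{m,n}$ and $$C>2^{p/2}\left(1-\frac12\left(\frac1m+\frac1n\right)\right)^{1/2}.$$ -/

import Mathlib

/-- A semi-metric on `X`: a metric without the triangle inequality. -/
structure SemiMetric (X : Type*) where
  dist : X → X → ℝ
  nonneg : ∀ x y, 0 ≤ dist x y
  symm : ∀ x y, dist x y = dist y x
  eq_zero_iff : ∀ x y, dist x y = 0 ↔ x = y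

/-- The power `d ^ p` (for `0 ≤ p`) of a semi-metric, which is again zero on the diagonal.
For `p > 0` this is just the pointwise power; for `p = 0` it is the discrete metric,
that is, the convention `0 ^ 0 = 0` is used on the diagonal. -/
noncomputable def SemiMetric.pow {X : Type*} (d : SemiMetric X) (p : ℝ) (x y : X) : ℝ :=
  open Classical in if x = y then 0 else d.dist x y ^ p

/-- `𝒪_n(ℝ)`: the real positive semidefinite (symmetric) matrices `Q` with `Q 1 = 0`. -/
def zeroSumPSD (n : ℕ) : Set (Matrix (Fin n) (Fin n) ℝ) :=
  {Q | Q.PosSemidef ∧ Q.mulVec (fun _ => (1 : ℝ)) = 0}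

/-- `∑_{q_ij > 0} d(x_i, x_j)^p q_ij + C² ∑_{q_ij < 0} d(x_i, x_j)^p q_ij`. -/
noncomputable def distortedForm {X : Type*} (d : SemiMetric X) (p C : ℝ) {n : ℕ}
    (x : Fin n → X) (Q : Matrix (Fin n) (Fin n) ℝ) : ℝ :=
  (∑ ij : Fin n × Fin n with 0 < Q ij.1 ij.2, d.pow p (x ij.1) (x ij.2) * Q ij.1 ij.2) +
    C ^ 2 * ∑ ij : Fin n × Fin n with Q ij.1 ij.2 < 0, d.pow p (x ij.1) (x ij.2) * Q ij.1 ij.2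

/-- `p`-negative type with distortion `C`. -/
def HasNegativeType {X : Type*} (d : SemiMetric X) (p C : ℝ) : Prop :=
  ∀ n : ℕ, 2 ≤ n → ∀ x : Fin n → X, Function.Injective x →
    ∀ Q ∈ zeroSumPSD n, distortedForm d p C x Q ≤ 0

/-- Strict `p`-negative type with distortion `C`: moreover equality holds only for `Q = 0`. -/
def HasStrictNegativeType {X : Type*} (d : SemiMetric X) (p C : ℝ) : Prop :=
  HasNegativeType d p C ∧
    ∀ n : ℕ, 2 ≤ n → ∀ x : Fin n → X, Function.Injective x →
      ∀ Q ∈ zeroSumPSD n, distortedForm d p C x Q = 0 → Q = 0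

/-- The metric of the complete bipartite graph `K_{m,n}` on the vertices `u_i = inl i` and
`v_j = inr j`: distinct vertices in the same part have distance 2, vertices in different parts
have distance 1. -/
def bipartiteMetric (m n : ℕ) : SemiMetric (Fin m ⊕ Fin n) where
  dist
    | .inl i, .inl j => if i = j then 0 else 2
    | .inr k, .inr l => if k = l then 0 else 2
    | .inl _, .inr _ => 1
    | .inr _, .inl _ => 1
  nonneg := by
    rintro (i | i) (j | j) <;> dsimp only <;> positivity
  symm := by
    rintro (i | i) (j | j) <;> simp [eq_comm]
  eq_zero_iff := by
    rintro (i | i) (j | j) <;> simp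

/-- `℘_{m,n} = log₂ (2mn / (2mn - m - n))`. -/
noncomputable def wpBipartite (m n : ℕ) : ℝ :=
  Real.logb 2 (2 * (m : ℝ) * n / (2 * (m : ℝ) * n - m - n))

open Finset

/-! Let `A` be the sum of `Q` over the block of indices mapped to the first part. Zero row sums make
the other diagonal block sum `A` and both off-diagonal ones `-A`, so the form is at most `2 * (2 ^ p
- C ^ 2) * A - 2 ^ p * Q.trace`. Positive semidefiniteness gives `A * (1 / m + 1 / n) ≤ Q.trace`, so
with `t = 1 - (1 / m + 1 / n) / 2` the form is at most `2 * A * (2 ^ p * t - C ^ 2)`. The vector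
with entries `1 / m` and `-1 / n` attains this bound with `A = 1`. Strict negative type thus means
`2 ^ p * t < C ^ 2`, and `p < wpBipartite m n` means `2 ^ p * t < 1`. -/

/-- The distorted form as a single sum over all pairs. -/
lemma distortedForm_eq_sum {X : Type*} (d : SemiMetric X) (p C : ℝ) {k : ℕ}
    (x : Fin k → X) (Q : Matrix (Fin k) (Fin k) ℝ) :
    distortedForm d p C x Q = ∑ i, ∑ j,
      ((if 0 < Q i j then d.pow p (x i) (x j) * Q i j else 0) +
        C ^ 2 * (if Q i j < 0 then d.pow p (x i) (x j) * Q i j else 0)) := by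
  unfold distortedForm
  rw [Finset.sum_filter, Finset.sum_filter, Finset.mul_sum, ← Finset.sum_add_distrib,
    Fintype.sum_prod_type]

/-- For a positive semidefinite matrix, the sum of the entries of a principal submatrix is at most
its size times its trace. -/
lemma Matrix.PosSemidef.sum_sum_le_card_mul {ι : Type*} [Fintype ι] [DecidableEq ι]
    {Q : Matrix ι ι ℝ} (hQ : Q.PosSemidef) (s : Finset ι) :
    ∑ i ∈ s, ∑ j ∈ s, Q i j ≤ #s * ∑ i ∈ s, Q i i := by
  have entry (i j : ι) : Q i j ≤ (Q i i + Q j j) / 2 := by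
    -- Testing on `e_i - e_j` gives `2 * Q i j ≤ Q i i + Q j j`.
    have h := hQ.dotProduct_mulVec_nonneg (Pi.single i 1 - Pi.single j 1)
    have hs : Q j i = Q i j := by simpa using hQ.isHermitian.apply i j
    simp [Matrix.mulVec_sub, sub_dotProduct, dotProduct_sub] at h
    linarith
  calc ∑ i ∈ s, ∑ j ∈ s, Q i j ≤ ∑ i ∈ s, ∑ j ∈ s, (Q i i + Q j j) / 2 :=
        sum_le_sum fun i _ => sum_le_sum fun j _ => entry i j
    _ = #s * ∑ i ∈ s, Q i i := by
        simp only [← sum_div, sum_add_distrib, sum_const, nsmul_eq_mul, ← mul_sum]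
        ring

/-- This is the quadratic form at the indicator vector of `s`. -/
lemma Matrix.PosSemidef.sum_sum_nonneg {ι : Type*} [Fintype ι] [DecidableEq ι]
    {Q : Matrix ι ι ℝ} (hQ : Q.PosSemidef) (s : Finset ι) :
    0 ≤ ∑ i ∈ s, ∑ j ∈ s, Q i j := by
  have h := hQ.dotProduct_mulVec_nonneg (fun i => if i ∈ s then 1 else 0)
  simpa [dotProduct, Matrix.mulVec, Finset.sum_ite_mem] using h

/-- The powers of the bipartite metric are `2 ^ p` inside a part and `1` across. -/
lemma bipartiteMetric_pow {m n : ℕ} (p : ℝ) (x y : Fin m ⊕ Fin n) :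
    (bipartiteMetric m n).pow p x y =
      if x = y then 0 else if x.isLeft = y.isLeft then 2 ^ p else 1 := by
  unfold SemiMetric.pow
  rcases x with i | i <;> rcases y with j | j
  · by_cases h : i = j <;> simp [bipartiteMetric, h]
  · simp [bipartiteMetric]
  · simp [bipartiteMetric]
  · by_cases h : i = j <;> simp [bipartiteMetric, h]

lemma card_filter_isLeft_le {m n k : ℕ} {x : Fin k → Fin m ⊕ Fin n}
    (hx : Function.Injective x) : #{i | (x i).isLeft = true} ≤ m := by
  calc #{i | (x i).isLeft = true} ≤ #((univ : Finset (Fin m)).map .inl) := by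
        refine card_le_card_of_injOn x (fun i hi => ?_) hx.injOn
        obtain ⟨a, ha⟩ := Sum.isLeft_iff.1 (by simpa using hi)
        simp [ha]
    _ = m := by simp

lemma card_filter_not_isLeft_le {m n k : ℕ} {x : Fin k → Fin m ⊕ Fin n}
    (hx : Function.Injective x) : #{i | ¬ (x i).isLeft = true} ≤ n := by
  calc #{i | ¬ (x i).isLeft = true} ≤ #((univ : Finset (Fin n)).map .inr) := by
        refine card_le_card_of_injOn x (fun i hi => ?_) hx.injOn
        obtain ⟨a, ha⟩ := Sum.isRight_iff.1 (by simpa using hi)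
        simp [ha]
    _ = n := by simp

/-- Splitting a matrix with zero row sums along a set of indices: the two principal block sums
agree, and both off-diagonal block sums are their negative. -/
lemma block_sums_of_sum_eq_zero {ι : Type*} [Fintype ι] {Q : ι → ι → ℝ}
    (hs : ∀ i j, Q j i = Q i j) (h0 : ∀ i, ∑ j, Q i j = 0) (P : ι → Prop) [DecidablePred P] :
    ∑ i with P i, ∑ j with ¬ P j, Q i j = -∑ i with P i, ∑ j with P j, Q i j ∧
    ∑ i with ¬ P i, ∑ j with P j, Q i j = -∑ i with P i, ∑ j with P j, Q i j ∧
    ∑ i with ¬ P i, ∑ j with ¬ P j, Q i j = ∑ i with P i, ∑ j with P j, Q i j := by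
  have row (i : ι) : ∑ j with ¬ P j, Q i j = -∑ j with P j, Q i j := by
    linarith [h0 i, sum_filter_add_sum_filter_not univ P (Q i)]
  have h1 : ∑ i with P i, ∑ j with ¬ P j, Q i j = -∑ i with P i, ∑ j with P j, Q i j := by
    simp [row]
  have h2 : ∑ i with ¬ P i, ∑ j with P j, Q i j = -∑ i with P i, ∑ j with P j, Q i j := by
    rw [sum_comm, ← h1]
    exact sum_congr rfl fun i _ => sum_congr rfl fun j _ => hs i j
  refine ⟨h1, h2, ?_⟩
  simp only [row, sum_neg_distrib, h2, neg_neg]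

/-- Upper bound of the distorted form: replace the weight by `2 ^ p` on all entries inside a part
and by `C ^ 2` on all entries across. -/
lemma distortedForm_bipartite_le {m n k : ℕ} {p C : ℝ} (hC : 1 ≤ C)
    {x : Fin k → Fin m ⊕ Fin n} (hx : Function.Injective x) {Q : Matrix (Fin k) (Fin k) ℝ}
    (hQ : Q ∈ zeroSumPSD k) :
    distortedForm (bipartiteMetric m n) p C x Q ≤
      2 * ((2 : ℝ) ^ p - C ^ 2) *
        (∑ i with (x i).isLeft = true, ∑ j with (x j).isLeft = true, Q i j) -
        2 ^ p * Q.trace := by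
  have hc : 1 ≤ C ^ 2 := by nlinarith
  have ha : (0 : ℝ) < 2 ^ p := by positivity
  -- As `1 ≤ C ^ 2`, raising the weight of a positive entry across parts, or lowering that of a
  -- negative entry inside a part, can only increase the sum. The subtracted term removes the
  -- diagonal, where the distance is zero.
  have entry (i j : Fin k) :
      (if 0 < Q i j then (bipartiteMetric m n).pow p (x i) (x j) * Q i j else 0) +
        C ^ 2 * (if Q i j < 0 then (bipartiteMetric m n).pow p (x i) (x j) * Q i j else 0) ≤
      (if (x i).isLeft = (x j).isLeft then (2 : ℝ) ^ p else C ^ 2) * Q i j -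
        if i = j then 2 ^ p * Q i j else 0 := by
    rw [bipartiteMetric_pow]
    simp only [hx.eq_iff]
    by_cases hij : i = j
    · subst hij; simp
    rcases lt_trichotomy (Q i j) 0 with h | h | h
    · split_ifs
      all_goals first | linarith | nlinarith [mul_neg_of_pos_of_neg ha h]
    · simp [h]
    · split_ifs
      all_goals first | linarith | nlinarith [mul_pos ha h]
  have h0 (i : Fin k) : ∑ j, Q i j = 0 := by
    simpa [Matrix.mulVec, dotProduct] using congrFun hQ.2 i
  have hs (i j : Fin k) : Q j i = Q i j := by simpa using hQ.1.isHermitian.apply i j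
  obtain ⟨h1, h2, h3⟩ := block_sums_of_sum_eq_zero hs h0 fun i => (x i).isLeft = true
  have split (f : Fin k → Fin k → ℝ) : ∑ i, ∑ j, f i j =
      (∑ i with (x i).isLeft = true, ∑ j with (x j).isLeft = true, f i j +
        ∑ i with (x i).isLeft = true, ∑ j with ¬ (x j).isLeft = true, f i j) +
      (∑ i with ¬ (x i).isLeft = true, ∑ j with (x j).isLeft = true, f i j +
        ∑ i with ¬ (x i).isLeft = true, ∑ j with ¬ (x j).isLeft = true, f i j) := by
    simp only [← sum_add_distrib, sum_filter_add_sum_filter_not]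
  have block (P R : Fin k → Prop) [DecidablePred P] [DecidablePred R] (c : ℝ)
      (h : ∀ i j, P i → R j → (if (x i).isLeft = (x j).isLeft then (2 : ℝ) ^ p else C ^ 2) = c) :
      ∑ i with P i, ∑ j with R j,
        (if (x i).isLeft = (x j).isLeft then (2 : ℝ) ^ p else C ^ 2) * Q i j =
      c * ∑ i with P i, ∑ j with R j, Q i j := by
    simp only [mul_sum]
    refine sum_congr rfl fun i hi => sum_congr rfl fun j hj => ?_
    rw [h i j (mem_filter.1 hi).2 (mem_filter.1 hj).2]
  rw [distortedForm_eq_sum]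
  refine (sum_le_sum fun i _ => sum_le_sum fun j _ => entry i j).trans_eq ?_
  simp only [sum_sub_distrib]
  rw [split, block _ _ (2 ^ p) (by intro i j hi hj; simp [hi, hj]),
    block _ _ (C ^ 2) (by intro i j hi hj; simp [hi, hj]),
    block _ _ (C ^ 2) (by intro i j hi hj; simp [hi, hj]),
    block _ _ (2 ^ p) (by intro i j hi hj; simp [Bool.eq_false_of_not_eq_true, hi, hj]),
    h1, h2, h3]
  simp only [sum_ite_eq, mem_univ, if_true, ← mul_sum, Matrix.trace, Matrix.diag]
  ring

/-- Above the threshold the distorted form is negative on nonzero matrices. -/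
lemma distortedForm_bipartite_neg {m n k : ℕ} (hm : 1 ≤ m) (hn : 1 ≤ n) {p C : ℝ} (hC : 1 ≤ C)
    (h : (2 : ℝ) ^ p * (1 - 1 / 2 * (1 / (m : ℝ) + 1 / (n : ℝ))) < C ^ 2)
    {x : Fin k → Fin m ⊕ Fin n} (hx : Function.Injective x) {Q : Matrix (Fin k) (Fin k) ℝ}
    (hQ : Q ∈ zeroSumPSD k) (hne : Q ≠ 0) :
    distortedForm (bipartiteMetric m n) p C x Q < 0 := by
  refine (distortedForm_bipartite_le hC hx hQ).trans_lt ?_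
  have ha : (0 : ℝ) < 2 ^ p := by positivity
  have hm' : (0 : ℝ) < m := by exact_mod_cast hm
  have hn' : (0 : ℝ) < n := by exact_mod_cast hn
  have h0 (i : Fin k) : ∑ j, Q i j = 0 := by
    simpa [Matrix.mulVec, dotProduct] using congrFun hQ.2 i
  have hs (i j : Fin k) : Q j i = Q i j := by simpa using hQ.1.isHermitian.apply i j
  obtain ⟨-, -, h3⟩ := block_sums_of_sum_eq_zero hs h0 fun i => (x i).isLeft = true
  have hU := hQ.1.sum_sum_le_card_mul {i | (x i).isLeft = true}
  have hV := hQ.1.sum_sum_le_card_mul {i | ¬ (x i).isLeft = true}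
  have hA := hQ.1.sum_sum_nonneg {i | (x i).isLeft = true}
  rw [h3] at hV
  set A := ∑ i with (x i).isLeft = true, ∑ j with (x j).isLeft = true, Q i j
  have hd (s : Finset (Fin k)) : 0 ≤ ∑ i ∈ s, Q i i := sum_nonneg fun i _ => hQ.1.diag_nonneg
  have hU' : A / m ≤ ∑ i with (x i).isLeft = true, Q i i := by
    rw [div_le_iff₀' hm']
    refine hU.trans (mul_le_mul_of_nonneg_right ?_ (hd _))
    exact_mod_cast card_filter_isLeft_le hx
  have hV' : A / n ≤ ∑ i with ¬ (x i).isLeft = true, Q i i := by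
    rw [div_le_iff₀' hn']
    refine hV.trans (mul_le_mul_of_nonneg_right ?_ (hd _))
    exact_mod_cast card_filter_not_isLeft_le hx
  have htr : Q.trace = ∑ i with (x i).isLeft = true, Q i i +
      ∑ i with ¬ (x i).isLeft = true, Q i i := by
    rw [sum_filter_add_sum_filter_not]; rfl
  have hD : A * (1 / m + 1 / n) ≤ Q.trace := by
    rw [htr]
    calc A * (1 / m + 1 / n) = A / m + A / n := by ring
      _ ≤ _ := add_le_add hU' hV'
  -- If `A = 0`, strictness comes from the trace, which vanishes only for `Q = 0`; otherwise it
  -- comes from `h`.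
  rcases hA.eq_or_lt with hA0 | hApos
  · have : 0 < Q.trace := by
      refine lt_of_le_of_ne hQ.1.trace_nonneg fun h' => hne ?_
      exact hQ.1.trace_eq_zero_iff.1 h'.symm
    rw [← hA0]
    nlinarith [mul_pos ha this]
  · nlinarith [mul_le_mul_of_nonneg_left hD ha.le, mul_pos hApos (sub_pos.2 h)]

/-- A relabelling of the vertices by `Fin (m + n)`, with the sign vector `(1/m, -1/n)` on them:
the distorted form of its rank one matrix. -/
lemma distortedForm_bipartite_vecMulVec {m n : ℕ} (hm : 1 ≤ m) (hn : 1 ≤ n) (p C : ℝ) :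
    let v : Fin (m + n) → ℝ := fun i =>
      Sum.elim (fun _ : Fin m => 1 / (m : ℝ)) (fun _ : Fin n => -(1 / (n : ℝ)))
        (finSumFinEquiv.symm i)
    Matrix.vecMulVec v v ∈ zeroSumPSD (m + n) ∧ Matrix.vecMulVec v v ≠ 0 ∧
    distortedForm (bipartiteMetric m n) p C finSumFinEquiv.symm (Matrix.vecMulVec v v) =
      2 * (2 ^ p * (1 - 1 / 2 * (1 / (m : ℝ) + 1 / (n : ℝ))) - C ^ 2) := by
  intro v
  have hm' : (0 : ℝ) < m := by exact_mod_cast hm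
  have hn' : (0 : ℝ) < n := by exact_mod_cast hn
  have hmm : (0 : ℝ) < (m : ℝ)⁻¹ := inv_pos.2 hm'
  have hnn : (0 : ℝ) < (n : ℝ)⁻¹ := inv_pos.2 hn'
  refine ⟨⟨?_, ?_⟩, ?_, ?_⟩
  · simpa using Matrix.posSemidef_vecMulVec_self_star v
  · have : ∑ i, v i = 0 := by
      rw [← finSumFinEquiv.sum_comp]
      simp [v, hm'.ne', hn'.ne']
    ext i
    simp [Matrix.mulVec, dotProduct, Matrix.vecMulVec_apply, ← mul_sum, this]
  · intro h
    have := congrFun (congrFun h (finSumFinEquiv (.inl ⟨0, hm⟩))) (finSumFinEquiv (.inl ⟨0, hm⟩))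
    simp only [Matrix.vecMulVec_apply, v, Equiv.symm_apply_apply, Sum.elim_inl,
      Matrix.zero_apply] at this
    exact (by positivity : (0 : ℝ) < 1 / m * (1 / m)).ne' this
  -- These signs let `simp` decide the conditions `0 < Q i j` and `Q i j < 0` on each block.
  · have hpm : 0 < (m : ℝ)⁻¹ * (m : ℝ)⁻¹ := mul_pos hmm hmm
    have hpn : 0 < (n : ℝ)⁻¹ * (n : ℝ)⁻¹ := mul_pos hnn hnn
    have hpmn : 0 < (m : ℝ)⁻¹ * (n : ℝ)⁻¹ := mul_pos hmm hnn
    have hpnm : 0 < (n : ℝ)⁻¹ * (m : ℝ)⁻¹ := mul_pos hnn hmm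
    have off {N : ℕ} (c : ℝ) : ∑ i : Fin N, ∑ j : Fin N, (if i = j then 0 else c) =
        N * (N * c) - N * c := by
      have (i j : Fin N) : (if i = j then 0 else c) = c - if i = j then c else 0 := by
        split_ifs <;> simp
      simp [this]
    rw [distortedForm_eq_sum, ← finSumFinEquiv.sum_comp]
    simp only [← finSumFinEquiv.sum_comp (fun j => _ + _), bipartiteMetric_pow]
    simp [Matrix.vecMulVec_apply, v, hpm, hpn, hpmn, hpnm, hpm.not_gt,
      hpn.not_gt, hpmn.not_gt, hpnm.not_gt, off, sum_add_distrib]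
    field_simp
    ring

/-- One inequality covers both ranges of `p`, and also `m = n = 1`, where its left side is `0`. -/
theorem hasStrictNegativeType_bipartite_iff {m n : ℕ} (hm : 1 ≤ m) (hn : 1 ≤ n) {p C : ℝ}
    (hC : 1 ≤ C) :
    HasStrictNegativeType (bipartiteMetric m n) p C ↔
      (2 : ℝ) ^ p * (1 - 1 / 2 * (1 / (m : ℝ) + 1 / (n : ℝ))) < C ^ 2 := by
  constructor
  · rintro ⟨hle, heq⟩
    obtain ⟨hQ, hne, hform⟩ := distortedForm_bipartite_vecMulVec hm hn p C
    have h1 := hle _ (by omega) _ finSumFinEquiv.symm.injective _ hQ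
    have h2 := mt (heq _ (by omega) _ finSumFinEquiv.symm.injective _ hQ) hne
    have := lt_of_le_of_ne h1 h2
    rw [hform] at this
    linarith
  · intro h
    refine ⟨fun k _ x hx Q hQ => ?_, fun k _ x hx Q hQ h0 => ?_⟩
    · by_cases hne : Q = 0
      · simp [hne, distortedForm]
      · exact (distortedForm_bipartite_neg hm hn hC h hx hQ hne).le
    · by_contra hne
      exact (distortedForm_bipartite_neg hm hn hC h hx hQ hne).ne h0

theorem corollary4p5 (m n : ℕ) (hm : 1 ≤ m) (hn : 1 ≤ n) (hmn : ¬ (m = 1 ∧ n = 1))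
    (p C : ℝ) (hp : 0 ≤ p) (hC : 1 ≤ C) :
    HasStrictNegativeType (bipartiteMetric m n) p C ↔
      p < wpBipartite m n ∨
        (wpBipartite m n ≤ p ∧
          (2 : ℝ) ^ (p / 2) * (1 - 1 / 2 * (1 / (m : ℝ) + 1 / (n : ℝ))) ^ (1 / 2 : ℝ) < C) := by
  have hm' : (1 : ℝ) ≤ m := by exact_mod_cast hm
  have hn' : (1 : ℝ) ≤ n := by exact_mod_cast hn
  have hden : (0 : ℝ) < 2 * m * n - m - n := by
    have : (3 : ℝ) ≤ m + n := by exact_mod_cast (by omega : 3 ≤ m + n)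
    -- `2mn - m - n = 2(m - 1)(n - 1) + (m + n - 2)`.
    nlinarith [mul_nonneg (sub_nonneg.2 hm') (sub_nonneg.2 hn')]
  rw [hasStrictNegativeType_bipartite_iff hm hn hC]
  have ht : 1 - 1 / 2 * (1 / (m : ℝ) + 1 / (n : ℝ)) = (2 * m * n - m - n) / (2 * m * n) := by
    field_simp
    ring
  have htpos : 0 < (2 * (m : ℝ) * n - m - n) / (2 * m * n) := by positivity
  rw [ht]
  have hwp : p < wpBipartite m n ↔
      (2 : ℝ) ^ p * ((2 * (m : ℝ) * n - m - n) / (2 * m * n)) < 1 := by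
    rw [wpBipartite, Real.lt_logb_iff_rpow_lt one_lt_two (by positivity), ← lt_div_iff₀ htpos,
      one_div_div]
  set t := (2 * (m : ℝ) * n - m - n) / (2 * m * n)
  have hroot : (2 : ℝ) ^ (p / 2) * t ^ (1 / 2 : ℝ) < C ↔ (2 : ℝ) ^ p * t < C ^ 2 := by
    have hsq : ((2 : ℝ) ^ (p / 2) * t ^ (1 / 2 : ℝ)) ^ 2 = 2 ^ p * t := by
      rw [mul_pow, ← Real.rpow_natCast, ← Real.rpow_mul zero_le_two, ← Real.sqrt_eq_rpow,
        Real.sq_sqrt htpos.le]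
      norm_num
    rw [← hsq, sq_lt_sq₀ (by positivity) (by linarith)]
  rw [hroot]
  constructor
  · intro h
    exact (lt_or_ge p (wpBipartite m n)).imp_right fun h' => ⟨h', h⟩
  · rintro (h | ⟨-, h⟩)
    -- Below the threshold `2 ^ p * t < 1`, so every `C ≥ 1` works.
    · exact (hwp.1 h).trans_le (one_le_pow₀ hC)
    · exact h
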